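/- A partial semigroup is a set $S$ with a partially defined binary operation $\ast$ such that for all $x,y,z\in S$, $(x\ast y)\ast z=x\ast(y\ast z)$, in the sense that if either side is defined then so is the other and they are equal. It is commutative if whenever $x\ast y$ is defined, $y\ast x$ is defined and $x\ast y=y\ast x$. Write $\mathcal P_f(X)$ for the set of nonempty finite subsets of $X$. For $s\in S$ let $\phi_S(s)=\{t\in S: s\ast t\text{ is defined}\}$, and for $H\in\mathcal P_f(S)$ let $\sigma_S(H)=\bigcap_{s\in H}\phi_S(s)$. $S$ is adequate if $\sigma_S(H)\ne\emptyset$ for every $H\in\mathcal P_f(S)$. Let $\delta S$ be the set of ultrafilters $p$ on $S$ such that $\phi_S(x)\in p$ for all $x\in S$. With $$p\ast q=\{A\subseteq S:\{a\in S: a^{-1}A\in q\}\in p\},\qquad a^{-1}A=\{t\in\phi_S(a): a\ast t\in A\},$$ $\delta S$ is a semigroup. Let $K(\delta S)$ be its smallest two-sided ideal. A set $A\subseteq S$ is central if there is an idempotent $p\in K(\delta S)$ with $A\in p$. A sequence $f:\mathbb N\to S$ is adequate if $\prod_{t\in F}f(t)$ (in increasing order of indices) is defined for every $F\in\mathcal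 P_f(\mathbb N)$ and, for every $K\in\mathcal P_f(S)$, there is $m\in\mathbb N$ such that $\prod_{t\in F}f(t)\in\sigma_S(K)$ for every $F\in\mathcal P_f(\mathbb N)$ with $\min F\ge m$. Let $\mathcal T_S$ be the set of adequate sequences in $S$. A set $A\subseteq S$ is a $C$-set if there are functions $\alpha:\mathcal P_f(\mathcal T_S)\to S$ and $H:\mathcal P_f(\mathcal T_S)\to\mathcal P_f(\mathbb N)$ such that 1. if $F,G\in\mathcal P_f(\mathcal T_S)$ and $F\subsetneq G$, then $\max H(F)<\min H(G)$; and 2. whenever $m\ge 1$, $G_1\subsetneq G_2\subsetneq\dots\subsetneq G_m$ are in $\mathcal P_f(\mathcal T_S)$ and $f_i\in G_i$ for $i=1,\dots,m$, the product $\prod_{i=1}^m\bigl(\alpha(G_i)\ast\prod_{t\in H(G_i)}f_i(t)\bigr)$ is defined and belongs to $A$. **Corollary.** Let $(S,\ast)$ be an adequate commutative partial semigroup and let $A\subseteq S$. If $A$ is a central set in $S$, then $A$ is a $C$-set in $S$. -/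

import Mathlib

/-- A partial semigroup: `op x y = none` means that `x ∗ y` is undefined. In `assoc`, either both
sides are undefined or both are defined and equal. -/
class PartialSemigroup (S : Type*) where
  op : S → S → Option S
  assoc : ∀ x y z : S, ((op x y).bind fun u => op u z) = ((op y z).bind fun v => op x v)

namespace PartialSemigroup

/-- Nonempty finite subsets. -/
abbrev Pf (X : Type*) : Type _ := {F : Finset X // F.Nonempty}

section Basic

variable {S : Type*} [PartialSemigroup S]

/-- `φ_S(s)`, the set of all `t` such that `s ∗ t` is defined. -/
def phi (s : S) : Set S := {t | (op s t).isSome}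

/-- `σ_S(H)`, the set of all `t` such that `s ∗ t` is defined for every `s ∈ H`. -/
def sigma (H : Pf S) : Set S := ⋂ s ∈ H.1, phi s

/-- `s⁻¹A`, the set of all `t ∈ φ_S(s)` with `s ∗ t ∈ A`. -/
def leftQuot (s : S) (A : Set S) : Set S := {t | ∃ u ∈ A, op s t = some u}

/-- The product of two possibly undefined elements, defined when both are and their product is. -/
def omul (u v : Option S) : Option S := u.bind fun a => v.bind fun b => op a b

/-- The product, in the order of the list, of finitely many possibly undefined elements. It is
undefined if a factor is. The empty product is undefined; it is never used below. -/
def listProd : List (Option S) → Option S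
  | [] => none
  | [u] => u
  | u :: v :: l => omul u (listProd (v :: l))

/-- `∏_{t ∈ H} f(t)`, in increasing order of indices. -/
def seqProd (f : ℕ → S) (H : Pf ℕ) : Option S :=
  listProd ((H.1.sort (· ≤ ·)).map fun t => some (f t))

/-- An adequate sequence: all finite products are defined, and for every `K` all finite products of
some tail lie in `σ_S(K)`. Sequences are indexed from `0`. -/
def IsAdequateSeq (y : ℕ → S) : Prop :=
  (∀ F : Pf ℕ, (seqProd y F).isSome) ∧
  ∀ K : Pf S, ∃ m : ℕ, ∀ F : Pf ℕ, (∀ n ∈ F.1, m ≤ n) → ∃ x ∈ sigma K, seqProd y F = some x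

end Basic

section Spaces

variable (S : Type*) [PartialSemigroup S]

/-- Commutativity: `x ∗ y` is defined iff `y ∗ x` is, and then they are equal. -/
def IsCommutative : Prop := ∀ x y : S, op x y = op y x

/-- `S` is adequate. -/
def IsAdequate : Prop := ∀ H : Pf S, (sigma H).Nonempty

/-- `𝒯_S`, the set of adequate sequences in `S`. -/
abbrev AdequateSeq : Type _ := {y : ℕ → S // IsAdequateSeq y}

/-- `δS`: the ultrafilters on `S` that contain `φ_S(x)` for every `x`. -/
abbrev Delta : Type _ := {p : Ultrafilter S // ∀ x : S, phi x ∈ p}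

end Spaces

section DeltaMul

variable {S : Type*} [PartialSemigroup S]

theorem leftQuot_compl_mem_iff (a : S) (A : Set S) (q : Delta S) :
    leftQuot a Aᶜ ∈ q.1 ↔ leftQuot a A ∉ q.1 := by
  rw [← Ultrafilter.compl_mem_iff_notMem]
  have h := q.2 a
  constructor
  · intro h1
    filter_upwards [h1] with t ht
    rintro ⟨v, hv, hv'⟩
    obtain ⟨u, hu, hu'⟩ := ht
    rw [hu'] at hv'
    cases hv'
    exact hu hv
  · intro h1
    filter_upwards [h1, h] with t ht ht'
    obtain ⟨u, hu⟩ := Option.isSome_iff_exists.1 ht'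
    exact ⟨u, fun hA => ht ⟨u, hA, hu⟩, hu⟩

/-- `p ∗ q = {A | {a | a⁻¹A ∈ q} ∈ p}` as an ultrafilter on `S`. -/
def ultraMul (p q : Delta S) : Ultrafilter S :=
  Ultrafilter.ofComplNotMemIff
    { sets := {A | {a | leftQuot a A ∈ q.1} ∈ p.1}
      univ_sets := by
        have : {a : S | leftQuot a Set.univ ∈ q.1} = Set.univ := by
          ext a
          simp only [Set.mem_ofPred_eq, Set.mem_univ, iff_true]
          filter_upwards [q.2 a] with t ht
          obtain ⟨u, hu⟩ := Option.isSome_iff_exists.1 ht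
          exact ⟨u, trivial, hu⟩
        simp only [Set.mem_ofPred_eq, this]
        exact Filter.univ_mem
      sets_of_superset := by
        intro A B hA hAB
        simp only [Set.mem_ofPred_eq] at hA ⊢
        filter_upwards [hA] with a ha
        filter_upwards [ha] with t ht
        obtain ⟨u, hu, hu'⟩ := ht
        exact ⟨u, hAB hu, hu'⟩
      inter_sets := by
        intro A B hA hB
        simp only [Set.mem_ofPred_eq] at hA hB ⊢
        filter_upwards [hA, hB] with a ha hb
        filter_upwards [ha, hb] with t ht ht'
        obtain ⟨u, hu, hu'⟩ := ht
        obtain ⟨v, hv, hv'⟩ := ht'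
        rw [hu'] at hv'
        cases hv'
        exact ⟨u, ⟨hu, hv⟩, hu'⟩ }
    (by
      intro A
      change {a | leftQuot a Aᶜ ∈ q.1} ∉ p.1 ↔ {a | leftQuot a A ∈ q.1} ∈ p.1
      have : {a : S | leftQuot a Aᶜ ∈ q.1} = {a | leftQuot a A ∈ q.1}ᶜ := by
        ext a
        exact leftQuot_compl_mem_iff a A q
      rw [this, Ultrafilter.compl_notMem_iff])

theorem mem_ultraMul (p q : Delta S) (A : Set S) :
    A ∈ ultraMul p q ↔ {a | leftQuot a A ∈ q.1} ∈ p.1 := Iff.rfl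

theorem leftQuot_leftQuot {a b c : S} (h : op a b = some c) (A : Set S) :
    leftQuot b (leftQuot a A) = leftQuot c A := by
  ext t
  have key := assoc a b t
  rw [h, Option.bind_some] at key
  constructor
  · rintro ⟨v, ⟨u, hu, hu'⟩, hv⟩
    rw [hv, Option.bind_some] at key
    exact ⟨u, hu, key.trans hu'⟩
  · rintro ⟨u, hu, hu'⟩
    rw [hu'] at key
    obtain ⟨v, hv, hv'⟩ := Option.bind_eq_some_iff.1 key.symm
    exact ⟨v, ⟨u, hu, hv'⟩, hv⟩

theorem leftQuot_leftQuot_of_none {a b : S} (h : op a b = none) (A : Set S) :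
    leftQuot b (leftQuot a A) = ∅ := by
  ext t
  simp only [Set.mem_empty_iff_false, iff_false]
  rintro ⟨v, ⟨u, hu, hu'⟩, hv⟩
  have key := assoc a b t
  rw [h, hv, Option.bind_none, Option.bind_some, hu'] at key
  cases key

theorem phi_mem_ultraMul (p q : Delta S) (x : S) : phi x ∈ ultraMul p q := by
  rw [mem_ultraMul]
  filter_upwards [p.2 x] with a ha
  obtain ⟨c, hc⟩ := Option.isSome_iff_exists.1 ha
  filter_upwards [q.2 c, q.2 a] with t ht ht'
  obtain ⟨u, hu⟩ := Option.isSome_iff_exists.1 ht'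
  refine ⟨u, ?_, hu⟩
  have key := assoc x a t
  rw [hc, hu, Option.bind_some, Option.bind_some] at key
  change (op x u).isSome
  rw [← key]
  exact ht

/-- The semigroup `(δS, ∗)`. -/
instance instSemigroupDelta : Semigroup (Delta S) where
  mul p q := ⟨ultraMul p q, phi_mem_ultraMul p q⟩
  mul_assoc p q r := by
    apply Subtype.ext
    apply Ultrafilter.ext
    intro A
    change {a | leftQuot a {x | leftQuot x A ∈ r.1} ∈ q.1} ∈ p.1 ↔
      {a | {b | leftQuot b (leftQuot a A) ∈ r.1} ∈ q.1} ∈ p.1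
    have : ∀ a : S, leftQuot a {x | leftQuot x A ∈ r.1} =
        {b | leftQuot b (leftQuot a A) ∈ r.1} := by
      intro a
      ext b
      constructor
      · rintro ⟨c, hc, hc'⟩
        change leftQuot b (leftQuot a A) ∈ r.1
        rw [leftQuot_leftQuot hc']
        exact hc
      · intro hb
        change leftQuot b (leftQuot a A) ∈ r.1 at hb
        cases hc : op a b with
        | none =>
          rw [leftQuot_leftQuot_of_none hc] at hb
          exact (Ultrafilter.empty_notMem hb).elim
        | some c =>
          rw [leftQuot_leftQuot hc] at hb
          exact ⟨c, hb, hc⟩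
    simp only [this]

end DeltaMul

/-- A two-sided ideal of a semigroup: a nonempty subset `I` with `T·I ⊆ I` and `I·T ⊆ I`. -/
def IsTwoSidedIdeal {T : Type*} [Semigroup T] (I : Set T) : Prop :=
  I.Nonempty ∧ (∀ t : T, ∀ x ∈ I, t * x ∈ I) ∧ ∀ x ∈ I, ∀ t : T, x * t ∈ I

/-- `K(T)`, the smallest two-sided ideal of `T`, as the intersection of all two-sided ideals. It is
the smallest one whenever a smallest one exists, and empty otherwise. -/
def minimalIdeal (T : Type*) [Semigroup T] : Set T :=
  ⋂ I ∈ {I : Set T | IsTwoSidedIdeal I}, I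

section Sets

variable {S : Type*} [PartialSemigroup S]

/-- A central set: a member of an idempotent of `K(δS)`. -/
def IsCentral (A : Set S) : Prop :=
  ∃ p : Delta S, p * p = p ∧ p ∈ minimalIdeal (Delta S) ∧ A ∈ p.1

/-- A C-set. `StrictMono G` says `G₁ ⊊ G₂ ⊊ … ⊊ G_m`; the last line says that
`∏_{i=1}^m (α(G_i) ∗ ∏_{t ∈ H(G_i)} f_i(t))` is defined and belongs to `A`. -/
def IsCSet (A : Set S) : Prop :=
  ∃ (α : Pf (AdequateSeq S) → S) (H : Pf (AdequateSeq S) → Pf ℕ),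
    (∀ F G : Pf (AdequateSeq S), F.1 ⊂ G.1 → ∀ s ∈ (H F).1, ∀ t ∈ (H G).1, s < t) ∧
    ∀ (m : ℕ) (G : Fin m → Pf (AdequateSeq S)) (f : Fin m → AdequateSeq S),
      0 < m → StrictMono G → (∀ i, f i ∈ (G i).1) →
      ∃ x ∈ A, listProd (List.ofFn fun i =>
        omul (some (α (G i))) (seqProd (f i).1 (H (G i)))) = some x

end Sets

end PartialSemigroup

/-! Fix an idempotent `p` in K(δS) with `A ∈ p`. For finitely many adequate sequences y_i, the
limits of tuples (a ∗ ∏_{t∈H} y_i(t))_i with min H → ∞ form a nonempty closed subset I of the power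
(δS)^ι. Commutativity makes I a subsemigroup that absorbs the diagonal of `p` on both sides. Such a
set contains the diagonal of `p` (`diagonal_mem_of_absorbing`): it contains an idempotent e with
coordinates in the minimal left ideal δS ∗ p, so p ∗ e_i = p for every i. Hence each member of `p`
contains a tuple of shifted products with a common a and H, and H arbitrarily late
(`exists_isShiftedProd_mem`).

The functions α and H are then built by recursion on the finite set of sequences. Earlier chain
products stay in A* = {x ∈ A : x⁻¹A ∈ p}. Since x⁻¹A* ∈ p for x ∈ A*, the finitely many conditions
at each step define a member of `p`, to which the previous statement applies. -/

open Filter Set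

/-! ### Compact right topological semigroups and their smallest ideal. -/

section CompactSemigroup

variable {T : Type*} [Semigroup T] [TopologicalSpace T] [CompactSpace T] [T2Space T]

/-- A compact right topological semigroup has a left ideal that is generated by each of its
elements. -/
theorem exists_minimal_leftIdeal [Nonempty T] (hT : ∀ r : T, Continuous (· * r)) :
    ∃ M : Set T, M.Nonempty ∧ (∀ t, ∀ x ∈ M, t * x ∈ M) ∧ ∀ x ∈ M, ∀ y ∈ M, ∃ u, u * x = y := by
  let C : Set (Set T) := {N | IsClosed N ∧ N.Nonempty ∧ ∀ t, ∀ x ∈ N, t * x ∈ N}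
  rsuffices ⟨M, hM⟩ : ∃ M, Minimal (· ∈ C) M
  · refine ⟨M, hM.prop.2.1, hM.prop.2.2, fun x hx y hy => ?_⟩
    -- T·x is a left ideal inside M, closed as a continuous image of a compact space, so minimality
    -- gives T·x = M.
    have hxM : Set.range (· * x) = M := by
      refine hM.eq_of_subset ⟨(isCompact_range (hT x)).isClosed, ⟨x * x, x, rfl⟩, ?_⟩ ?_
      · rintro t _ ⟨u, rfl⟩
        exact ⟨t * u, mul_assoc _ _ _⟩
      · rintro _ ⟨u, rfl⟩
        exact hM.prop.2.2 u x hx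
    rw [← hxM] at hy
    exact hy
  refine zorn_superset _ fun c hcC hc => ?_
  refine ⟨⋂₀ c, ⟨isClosed_sInter fun t ht => (hcC ht).1, ?_, fun t x hx s hs =>
    (hcC hs).2.2 t x (hx s hs)⟩, fun s hs => Set.sInter_subset_of_mem hs⟩
  obtain rfl | hne := c.eq_empty_or_nonempty
  · rw [Set.sInter_empty]
    exact Set.univ_nonempty
  · rw [Set.sInter_eq_iInter]
    have := hne.coe_sort
    exact IsCompact.nonempty_iInter_of_directed_nonempty_isCompact_isClosed _
      (DirectedOn.directed_val (IsChain.directedOn hc.symm)) (fun i => (hcC i.prop).2.1)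
      (fun i => (hcC i.prop).1.isCompact) (fun i => (hcC i.prop).1)

/-- For a minimal left ideal M, the set M·T is a two-sided ideal, so p = x * t with x ∈ M. As u * x
generates M, some v sends it back to x. -/
theorem PartialSemigroup.exists_mul_mul_eq_of_mem_minimalIdeal (hT : ∀ r : T, Continuous (· * r))
    {p : T} (hp : p ∈ minimalIdeal T) (u : T) : ∃ v, v * (u * p) = p := by
  have : Nonempty T := ⟨p⟩
  obtain ⟨M, ⟨x₀, hx₀⟩, hmul, hgen⟩ := exists_minimal_leftIdeal hT
  have hI : IsTwoSidedIdeal {z : T | ∃ x ∈ M, ∃ t, x * t = z} := by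
    refine ⟨⟨x₀ * p, x₀, hx₀, p, rfl⟩, ?_, ?_⟩
    · rintro t _ ⟨x, hx, s, rfl⟩
      exact ⟨t * x, hmul t x hx, s, mul_assoc _ _ _⟩
    · rintro _ ⟨x, hx, s, rfl⟩ t
      exact ⟨x, hx, s * t, (mul_assoc _ _ _).symm⟩
  obtain ⟨x, hx, t, rfl⟩ := Set.mem_iInter₂.1 hp _ hI
  obtain ⟨v, hv⟩ := hgen (u * x) (hmul u x hx) x hx
  exact ⟨v, by rw [← mul_assoc u, ← mul_assoc, hv]⟩

/-- The diagonal of an element of `K(T)` lies in each closed subsemigroup of a power of `T` that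
absorbs it on both sides. -/
theorem PartialSemigroup.diagonal_mem_of_absorbing {ι : Type*} (hT : ∀ r : T, Continuous (· * r))
    {p : T} (hp : p ∈ minimalIdeal T) {I : Set (ι → T)} (hclosed : IsClosed I)
    (hne : I.Nonempty) (hmul : ∀ r ∈ I, ∀ s ∈ I, r * s ∈ I)
    (hleft : ∀ r ∈ I, (fun _ => p) * r ∈ I) (hright : ∀ r ∈ I, r * (fun _ => p) ∈ I) :
    (fun _ => p) ∈ I := by
  have hc : ∀ r : ι → T, Continuous (· * r) := fun r =>
    continuous_pi fun i => (hT (r i)).comp (continuous_apply i)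
  obtain ⟨_, ⟨r, hr, rfl⟩, he⟩ := exists_idempotent_in_compact_subsemigroup hc
    ((· * fun _ => p) '' I) (hne.image _) (hclosed.isCompact.image (hc _)) (by
      rintro _ ⟨r, hr, rfl⟩ _ ⟨s, hs, rfl⟩
      exact ⟨r * (fun _ => p) * s, hmul _ (hright r hr) _ hs, mul_assoc _ _ _⟩)
  -- Each coordinate e_i = r_i * p is idempotent and p ∈ T·e_i, so e_i is a right identity for p.
  have key : (fun _ => p) * (r * fun _ => p) = fun _ : ι => p := by
    funext i
    obtain ⟨v, hv⟩ := exists_mul_mul_eq_of_mem_minimalIdeal hT hp (r i)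
    have hi : r i * p * (r i * p) = r i * p := congrFun he i
    calc p * (r i * p) = v * (r i * p) * (r i * p) := by rw [hv]
      _ = p := by rw [mul_assoc, hi, hv]
  rw [← key]
  exact hleft _ (hright r hr)

end CompactSemigroup

namespace PartialSemigroup

/-! ### Products of possibly undefined elements. -/

section Algebra

variable {S : Type*} [PartialSemigroup S]

theorem omul_assoc (u v w : Option S) : omul (omul u v) w = omul u (omul v w) := by
  cases u <;> cases v <;> cases w <;> try simp [omul]
  exact assoc _ _ _

theorem IsCommutative.omul_comm (h : IsCommutative S) (u v : Option S) : omul u v = omul v u := by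
  cases u <;> cases v <;> simp [omul, h _ _]

theorem IsCommutative.omul_omul_omul_comm (h : IsCommutative S) (a b c d : Option S) :
    omul (omul a b) (omul c d) = omul (omul a c) (omul b d) := by
  rw [omul_assoc, omul_assoc, ← omul_assoc b, h.omul_comm b c, omul_assoc c]

theorem exists_of_omul_eq_some {u v : Option S} {x : S} (h : omul u v = some x) :
    ∃ a b, u = some a ∧ v = some b ∧ op a b = some x := by
  obtain ⟨a, ha, h⟩ := Option.bind_eq_some_iff.1 h
  obtain ⟨b, hb, h⟩ := Option.bind_eq_some_iff.1 h
  exact ⟨a, b, ha, hb, h⟩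

theorem listProd_append {l l' : List (Option S)} (h : l ≠ []) (h' : l' ≠ []) :
    listProd (l ++ l') = omul (listProd l) (listProd l') := by
  induction l with
  | nil => exact absurd rfl h
  | cons u l ih =>
    cases l with
    | nil =>
      cases l' with
      | nil => exact absurd rfl h'
      | cons v l' => rfl
    | cons v l =>
      change omul u (listProd (v :: l ++ l')) = omul (omul u (listProd (v :: l))) (listProd l')
      rw [ih (List.cons_ne_nil _ _), omul_assoc]

theorem sort_union_of_lt {H H' : Finset ℕ} (h : ∀ s ∈ H, ∀ t ∈ H', s < t) :
    (H ∪ H').sort (· ≤ ·) = H.sort (· ≤ ·) ++ H'.sort (· ≤ ·) := by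
  have hnd : (H.sort (· ≤ ·) ++ H'.sort (· ≤ ·)).Nodup := by
    refine List.nodup_append.2 ⟨H.sort_nodup _, H'.sort_nodup _, fun s hs t ht => ?_⟩
    exact (h s ((Finset.mem_sort _).1 hs) t ((Finset.mem_sort _).1 ht)).ne
  have hu : H ∪ H' = (H.sort (· ≤ ·) ++ H'.sort (· ≤ ·)).toFinset := by
    rw [List.toFinset_append, Finset.sort_toFinset, Finset.sort_toFinset]
  rw [hu, List.toFinset_sort _ hnd, List.pairwise_append]
  exact ⟨H.pairwise_sort _, H'.pairwise_sort _, fun s hs t ht =>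
    (h s ((Finset.mem_sort _).1 hs) t ((Finset.mem_sort _).1 ht)).le⟩

theorem seqProd_union (y : ℕ → S) {H H' : Pf ℕ} (h : ∀ s ∈ H.1, ∀ t ∈ H'.1, s < t) :
    seqProd y ⟨H.1 ∪ H'.1, H.2.mono Finset.subset_union_left⟩ =
      omul (seqProd y H) (seqProd y H') := by
  have hne : ∀ G : Pf ℕ, (G.1.sort (· ≤ ·)).map (fun t => some (y t)) ≠ [] := by
    intro G hG
    have hlen := congrArg List.length hG
    rw [List.length_map, Finset.length_sort] at hlen
    exact G.2.card_pos.ne' hlen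
  unfold seqProd
  rw [sort_union_of_lt h, List.map_append, listProd_append (hne H) (hne H')]

end Algebra

/-! ### The compact semigroup δS and limits of shifted products. -/

section Topology

variable {S : Type*} [PartialSemigroup S]

instance Delta.instCompactSpace : CompactSpace (Delta S) := by
  refine isCompact_iff_compactSpace.1
    (IsClosed.isCompact (s := {p : Ultrafilter S | ∀ x : S, phi x ∈ p}) ?_)
  rw [Set.ofPred_forall]
  exact isClosed_iInter fun x => ultrafilter_isClosed_basic _

theorem Delta.continuous_mul_right (q : Delta S) : Continuous (· * q) := by
  refine Continuous.subtype_mk ?_ _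
  refine ultrafilterBasis_is_basis.continuous_iff.2 ?_
  rintro _ ⟨A, rfl⟩
  exact (ultrafilter_isOpen_basic {a | leftQuot a A ∈ q.1}).preimage continuous_subtype_val

theorem Delta.mem_mul {p q : Delta S} {A : Set S} :
    A ∈ (p * q).1 ↔ {a | leftQuot a A ∈ q.1} ∈ p.1 := Iff.rfl

/-- `x i = a ∗ ∏_{t ∈ H} y i t` for some `a` and some `H` with `k ≤ min H`. -/
def IsShiftedProd {ι : Type*} (y : ι → ℕ → S) (k : ℕ) (x : ι → S) : Prop :=
  ∃ (a : S) (H : Pf ℕ), (∀ n ∈ H.1, k ≤ n) ∧ ∀ i, omul (some a) (seqProd (y i) H) = some (x i)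

/-- The tuples of ultrafilters all of whose neighbourhoods contain, for every `k`, a tuple of
shifted products with indices at least `k`. -/
def shiftedLimits {ι : Type*} (y : ι → ℕ → S) : Set (ι → Delta S) :=
  {r | ∀ (k : ℕ) (B : ι → Set S), (∀ i, B i ∈ (r i).1) → ∃ x, IsShiftedProd y k x ∧ ∀ i, x i ∈ B i}

variable {ι : Type*} {y : ι → ℕ → S}

theorem isClosed_shiftedLimits [Finite ι] : IsClosed (shiftedLimits y) := by
  have : shiftedLimits y = ⋂ (k : ℕ) (B : ι → Set S)
      (_ : ¬ ∃ x, IsShiftedProd y k x ∧ ∀ i, x i ∈ B i),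
      {r : ι → Delta S | ∀ i, B i ∈ (r i).1}ᶜ := by
    ext r
    simp only [shiftedLimits, Set.mem_iInter, Set.mem_compl_iff, Set.mem_ofPred_eq]
    exact forall₂_congr fun k B => not_imp_not.symm
  rw [this]
  refine isClosed_iInter fun k => isClosed_iInter fun B => isClosed_iInter fun _ => ?_
  rw [isClosed_compl_iff, Set.ofPred_forall]
  exact isOpen_iInter_of_finite fun i => (ultrafilter_isOpen_basic (B i)).preimage
    (continuous_subtype_val.comp (continuous_apply i))

/-- One late index n suffices: y_i(n) can be multiplied on the left by a and by every l ∗ a, so l ∗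
(a ∗ y_i(n)) is defined by associativity. -/
theorem exists_isShiftedProd [Finite ι] (hadeq : IsAdequate S) [Nonempty S] (hy : ∀ i, IsAdequateSeq (y i))
    (k : ℕ) (L : Finset S) : ∃ x, IsShiftedProd y k x ∧ ∀ i, ∀ l ∈ L, x i ∈ phi l := by
  classical
  have := Fintype.ofFinite ι
  obtain ⟨s⟩ := ‹Nonempty S›
  -- The element s only keeps the set nonempty when L is empty.
  obtain ⟨a, ha⟩ := hadeq ⟨insert s L, Finset.insert_nonempty _ _⟩
  have hla : ∀ l ∈ L, (op l a).isSome := fun l hl =>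
    Set.mem_iInter₂.1 ha l (Finset.mem_insert_of_mem hl)
  -- The default of `getD` never occurs, since l ∗ a is defined for l ∈ L.
  let K : Pf S := ⟨insert a (L.image fun l => (op l a).getD a), Finset.insert_nonempty _ _⟩
  choose m hm using fun i => (hy i).2 K
  let n := max k (Finset.univ.sup m)
  have hP : ∀ i, ∃ x ∈ sigma K, seqProd (y i) ⟨{n}, Finset.singleton_nonempty _⟩ = some x := by
    intro i
    refine hm i _ fun t ht => ?_
    rw [Finset.mem_singleton.1 ht]
    exact (Finset.le_sup (Finset.mem_univ i)).trans (le_max_right _ _)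
  choose P hPK hP using hP
  have haP : ∀ i, (op a (P i)).isSome := fun i =>
    Set.mem_iInter₂.1 (hPK i) a (Finset.mem_insert_self _ _)
  choose x hx using fun i => Option.isSome_iff_exists.1 (haP i)
  refine ⟨x, ⟨a, _, fun t ht => ?_, fun i => (congrArg (omul (some a)) (hP i)).trans (hx i)⟩, ?_⟩
  · rw [Finset.mem_singleton.1 ht]
    exact le_max_left _ _
  · intro i l hl
    obtain ⟨c, hc⟩ := Option.isSome_iff_exists.1 (hla l hl)
    have hcP : (op c (P i)).isSome := by
      refine Set.mem_iInter₂.1 (hPK i) c (Finset.mem_insert_of_mem (Finset.mem_image.2 ⟨l, hl, ?_⟩))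
      rw [hc, Option.getD_some]
    have key := assoc l a (P i)
    rw [hc, hx i, Option.bind_some, Option.bind_some] at key
    change (op l (x i)).isSome
    rwa [← key]

/-- Take the coordinate projections of one ultrafilter on the power of S that contains all sets `X
c`. The finite sets L force the projections into δS. -/
theorem shiftedLimits_nonempty [Finite ι] (hadeq : IsAdequate S) [Nonempty S]
    (hy : ∀ i, IsAdequateSeq (y i)) : (shiftedLimits y).Nonempty := by
  classical
  let X : ℕ × Finset S → Set (ι → S) := fun c =>
    {x | IsShiftedProd y c.1 x ∧ ∀ i, ∀ l ∈ c.2, x i ∈ phi l}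
  have hX : Antitone X := by
    rintro ⟨k, L⟩ ⟨k', L'⟩ ⟨hk, hL⟩ x ⟨⟨a, H, hH, hx⟩, hx'⟩
    exact ⟨⟨a, H, fun n hn => hk.trans (hH n hn), hx⟩, fun i l hl => hx' i l (hL hl)⟩
  have hne : (⨅ c, 𝓟 (X c)).NeBot := by
    refine Filter.iInf_neBot_of_directed ?_ fun c => ?_
    · exact Antitone.directed_ge fun c c' h => Filter.principal_mono.2 (hX h)
    · exact Filter.principal_neBot_iff.2 (exists_isShiftedProd hadeq hy c.1 c.2)
  let U := Ultrafilter.of (⨅ c, 𝓟 (X c))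
  have hU : ∀ c, X c ∈ U := fun c =>
    (Ultrafilter.of_le _).trans (iInf_le _ c) (Filter.mem_principal_self _)
  refine ⟨fun i => ⟨U.map fun x => x i, fun s => ?_⟩, fun k B hB => ?_⟩
  · rw [Ultrafilter.mem_map]
    filter_upwards [hU (0, {s})] with x hx
    exact hx.2 i s (Finset.mem_singleton_self s)
  · have hB' : ∀ᶠ x in (U : Filter (ι → S)), ∀ i, x i ∈ B i := Filter.eventually_all.2 hB
    obtain ⟨x, hx, hxB⟩ := U.nonempty_of_mem (Filter.inter_mem (hU (k, ∅)) hB')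
    exact ⟨x, hx.1, hxB⟩

/-- Commutativity regroups (a ∗ ∏_H) ∗ (a' ∗ ∏_H') as (a ∗ a') ∗ ∏_{H ∪ H'}, once H' lies beyond H.
-/
theorem mul_mem_shiftedLimits (hcomm : IsCommutative S) {r s : ι → Delta S}
    (hr : r ∈ shiftedLimits y) (hs : s ∈ shiftedLimits y) : r * s ∈ shiftedLimits y := by
  intro k B hB
  obtain ⟨x, ⟨a, H, hH, hx⟩, hxB⟩ := hr k _ hB
  obtain ⟨x', ⟨a', H', hH', hx'⟩, hxB'⟩ := hs (max k (H.1.sup id + 1)) _ hxB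
  have hlt : ∀ t ∈ H.1, ∀ t' ∈ H'.1, t < t' := fun t ht t' ht' =>
    Nat.lt_of_lt_of_le (Nat.lt_succ_of_le (Finset.le_sup (f := id) ht))
      ((le_max_right _ _).trans (hH' t' ht'))
  choose z hzB hz using hxB'
  have hz' : ∀ i, omul (omul (some a) (some a'))
      (seqProd (y i) ⟨H.1 ∪ H'.1, H.2.mono Finset.subset_union_left⟩) = some (z i) := by
    intro i
    rw [seqProd_union _ hlt, hcomm.omul_omul_omul_comm, hx i, hx' i]
    exact hz i
  -- Some coordinate is needed to know that a ∗ a' is defined.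
  obtain hι | ⟨⟨i⟩⟩ := isEmpty_or_nonempty ι
  · exact ⟨x, ⟨a, H, hH, hx⟩, fun i => hι.elim i⟩
  obtain ⟨b, -, hb, -⟩ := exists_of_omul_eq_some (hz' i)
  refine ⟨z, ⟨b, _, fun n hn => ?_, fun i => hb ▸ hz' i⟩, hzB⟩
  obtain hn | hn := Finset.mem_union.1 hn
  · exact hH n hn
  · exact (le_max_left _ _).trans (hH' n hn)

/-- A factor c on the left is absorbed into the shift; finiteness of ι lets one c serve all
coordinates. -/
theorem const_mul_mem_shiftedLimits [Finite ι] {r : ι → Delta S} (p : Delta S) (hr : r ∈ shiftedLimits y) :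
    (fun _ => p) * r ∈ shiftedLimits y := by
  intro k B hB
  have hB' : ∀ᶠ c in (p.1 : Filter S), ∀ i, leftQuot c (B i) ∈ (r i).1 :=
    Filter.eventually_all.2 hB
  obtain ⟨c, hc⟩ := hB'.exists
  obtain ⟨x, ⟨a, H, hH, hx⟩, hxB⟩ := hr k _ hc
  choose z hzB hz using hxB
  have hz' : ∀ i, omul (omul (some c) (some a)) (seqProd (y i) H) = some (z i) := by
    intro i
    rw [omul_assoc, hx i]
    exact hz i
  obtain hι | ⟨⟨i⟩⟩ := isEmpty_or_nonempty ι
  · exact ⟨x, ⟨a, H, hH, hx⟩, fun i => hι.elim i⟩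
  obtain ⟨b, -, hb, -⟩ := exists_of_omul_eq_some (hz' i)
  exact ⟨z, ⟨b, H, hH, fun i => hb ▸ hz' i⟩, hzB⟩

theorem mul_const_mem_shiftedLimits [Finite ι] (hcomm : IsCommutative S) {r : ι → Delta S} (p : Delta S)
    (hr : r ∈ shiftedLimits y) : r * (fun _ => p) ∈ shiftedLimits y := by
  intro k B hB
  obtain ⟨x, ⟨a, H, hH, hx⟩, hxB⟩ := hr k _ hB
  have hxB' : ∀ᶠ c in (p.1 : Filter S), ∀ i, c ∈ leftQuot (x i) (B i) :=
    Filter.eventually_all.2 hxB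
  obtain ⟨c, hc⟩ := hxB'.exists
  choose z hzB hz using hc
  -- Commutativity moves the right factor c to the left, into the shift.
  have hz' : ∀ i, omul (omul (some c) (some a)) (seqProd (y i) H) = some (z i) := by
    intro i
    rw [omul_assoc, hx i, hcomm.omul_comm]
    exact hz i
  obtain hι | ⟨⟨i⟩⟩ := isEmpty_or_nonempty ι
  · exact ⟨x, ⟨a, H, hH, hx⟩, fun i => hι.elim i⟩
  obtain ⟨b, -, hb, -⟩ := exists_of_omul_eq_some (hz' i)
  exact ⟨z, ⟨b, H, hH, fun i => hb ▸ hz' i⟩, hzB⟩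

/-- Members of elements of `K(δS)` are J-sets. -/
theorem exists_isShiftedProd_mem [Finite ι] (hcomm : IsCommutative S) (hadeq : IsAdequate S)
    (hy : ∀ i, IsAdequateSeq (y i)) {p : Delta S}
    (hp : p ∈ minimalIdeal (Delta S)) {B : Set S} (hB : B ∈ p.1) (k : ℕ) :
    ∃ x, IsShiftedProd y k x ∧ ∀ i, x i ∈ B := by
  have : Nonempty S := (p.1.nonempty_of_mem hB).to_type
  exact diagonal_mem_of_absorbing Delta.continuous_mul_right hp isClosed_shiftedLimits
    (shiftedLimits_nonempty hadeq hy) (fun r hr s hs => mul_mem_shiftedLimits hcomm hr hs)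
    (fun r hr => const_mul_mem_shiftedLimits p hr)
    (fun r hr => mul_const_mem_shiftedLimits hcomm p hr) k (fun _ => B) fun _ => hB

end Topology

/-! ### Recursive construction of α and H. -/

section Construction

variable {S : Type*} [PartialSemigroup S]

/-- The points of `A` from which one can continue inside `A` along `p`. -/
def starSet (p : Delta S) (A : Set S) : Set S := {x | x ∈ A ∧ leftQuot x A ∈ p.1}

theorem starSet_mem {p : Delta S} (hpp : p * p = p) {A : Set S} (hA : A ∈ p.1) :
    starSet p A ∈ p.1 := by
  have h : A ∈ (p * p).1 := by rwa [hpp]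
  exact Filter.inter_mem hA h

/-- As x⁻¹A ∈ p = p ∗ p, for p-most t both x ∗ t ∈ A and t⁻¹(x⁻¹A) ∈ p, and the latter set is (x ∗
t)⁻¹A. -/
theorem leftQuot_starSet_mem {p : Delta S} (hpp : p * p = p) {A : Set S} {x : S}
    (hx : x ∈ starSet p A) : leftQuot x (starSet p A) ∈ p.1 := by
  have h : leftQuot x A ∈ (p * p).1 := by
    rw [hpp]
    exact hx.2
  filter_upwards [hx.2, Delta.mem_mul.1 h] with t ht ht'
  obtain ⟨u, hu, hxt⟩ := ht
  refine ⟨u, ⟨hu, ?_⟩, hxt⟩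
  rw [← leftQuot_leftQuot hxt]
  exact ht'

/-- Recursion along a well-founded relation, where each value is chosen in terms of the previous
ones. -/
theorem exists_forall_of_wellFounded {X β : Type*} {r : X → X → Prop} (hr : WellFounded r)
    (R : ∀ F : X, (∀ G, r G F → β) → β → Prop) (h : ∀ F prev, ∃ d, R F prev d) :
    ∃ D : X → β, ∀ F, R F (fun G _ => D G) (D F) := by
  choose c hc using h
  refine ⟨hr.fix c, fun F => ?_⟩
  rw [hr.fix_eq]
  exact hc F _

/-- A step of the recursive construction: the shift, the index set, and the finitely many products
over chains that end at the present set of sequences. -/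
abbrev ChainData (B : Set S) : Type _ := S × Pf ℕ × {V : Finset S // ∀ x ∈ V, x ∈ B}

/-- The condition on the data at `F` in terms of the data at the proper subsets of `F`. -/
def ChainData.Extends {B : Set S} (F : Pf (AdequateSeq S))
    (prev : ∀ G : Pf (AdequateSeq S), G.1 ⊂ F.1 → ChainData B) (d : ChainData B) : Prop :=
  (∀ G hG, ∀ s ∈ (prev G hG).2.1.1, ∀ t ∈ d.2.1.1, s < t) ∧
  ∀ f ∈ F.1, ∃ z ∈ d.2.2.1, omul (some d.1) (seqProd f.1 d.2.1) = some z ∧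
    ∀ G hG, ∀ x ∈ (prev G hG).2.2.1, ∃ w ∈ d.2.2.1, op x z = some w

theorem ChainData.exists_extends (hcomm : IsCommutative S) (hadeq : IsAdequate S) {p : Delta S}
    (hpp : p * p = p) (hp : p ∈ minimalIdeal (Delta S)) {A : Set S} (hA : A ∈ p.1)
    (F : Pf (AdequateSeq S))
    (prev : ∀ G : Pf (AdequateSeq S), G.1 ⊂ F.1 → ChainData (starSet p A)) :
    ∃ d, ChainData.Extends F prev d := by
  classical
  let ι := {G : Pf (AdequateSeq S) // G.1 ⊂ F.1}
  have : Finite ι := by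
    refine Finite.of_injective (β := F.1.powerset)
      (fun G => ⟨G.1.1, Finset.mem_powerset.2 G.2.1⟩) fun G G' h => ?_
    exact Subtype.ext (Subtype.ext (Subtype.mk.inj h))
  have := Fintype.ofFinite ι
  -- W collects all earlier chain products, and k exceeds all earlier indices. Both exist because F
  -- has finitely many proper subsets.
  let W : Finset S := Finset.univ.biUnion fun G : ι => (prev G.1 G.2).2.2.1
  let k : ℕ := Finset.univ.sup fun G : ι => (prev G.1 G.2).2.1.1.sup id + 1
  have hW : ∀ x ∈ W, x ∈ starSet p A := by
    intro x hx
    obtain ⟨G, -, hG⟩ := Finset.mem_biUnion.1 hx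
    exact (prev G.1 G.2).2.2.2 x hG
  have hB : starSet p A ∩ ⋂ x ∈ W, leftQuot x (starSet p A) ∈ p.1 :=
    Filter.inter_mem (starSet_mem hpp hA)
      ((Filter.biInter_finset_mem W).2 fun x hx => leftQuot_starSet_mem hpp (hW x hx))
  obtain ⟨z, ⟨a, H, hH, hz⟩, hzB⟩ := exists_isShiftedProd_mem (ι := F.1) (y := fun f => f.1.1)
    hcomm hadeq (fun f => f.1.2) hp hB k
  have hxz : ∀ x ∈ W, ∀ f, ∃ w ∈ starSet p A, op x (z f) = some w := fun x hx f =>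
    Set.mem_iInter₂.1 (hzB f).2 x hx
  -- Chains consisting of F alone give the z f, longer ones the x ∗ z f. The latter are defined, so
  -- the default of `getD` never occurs.
  let V : Finset S := Finset.univ.image z ∪
    (W ×ˢ Finset.univ).image fun c => (op c.1 (z c.2)).getD c.1
  refine ⟨⟨a, H, V, fun v hv => ?_⟩, fun G hG s hs t ht => ?_, fun f hf => ?_⟩
  · obtain hv | hv := Finset.mem_union.1 hv
    · obtain ⟨f, -, rfl⟩ := Finset.mem_image.1 hv
      exact (hzB f).1
    · obtain ⟨⟨x, f⟩, hc, rfl⟩ := Finset.mem_image.1 hv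
      obtain ⟨w, hw, hxw⟩ := hxz x (Finset.mem_product.1 hc).1 f
      rw [hxw]
      exact hw
  · refine Nat.lt_of_lt_of_le (Nat.lt_succ_of_le (Finset.le_sup (f := id) hs)) (le_trans ?_ (hH t ht))
    exact Finset.le_sup (f := fun G : ι => (prev G.1 G.2).2.1.1.sup id + 1)
      (Finset.mem_univ (⟨G, hG⟩ : ι))
  · refine ⟨z ⟨f, hf⟩, Finset.mem_union_left _ (Finset.mem_image_of_mem z (Finset.mem_univ _)),
      hz ⟨f, hf⟩, fun G hG x hx => ?_⟩
    have hxW : x ∈ W := Finset.mem_biUnion.2 ⟨⟨G, hG⟩, Finset.mem_univ _, hx⟩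
    obtain ⟨w, -, hxw⟩ := hxz x hxW ⟨f, hf⟩
    refine ⟨w, Finset.mem_union_right _ (Finset.mem_image.2 ⟨(x, ⟨f, hf⟩),
      Finset.mem_product.2 ⟨hxW, Finset.mem_univ _⟩, ?_⟩), hxw⟩
    rw [hxw, Option.getD_some]

/-- Induction on the length, splitting off the last factor. Membership in the finite set recorded at
the last term, rather than just in B, is what lets the next step extend the product. -/
theorem ChainData.listProd_mem {B : Set S} {D : Pf (AdequateSeq S) → ChainData B}
    (hD : ∀ F, ChainData.Extends F (fun G _ => D G) (D F)) (m : ℕ)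
    (G : Fin (m + 1) → Pf (AdequateSeq S)) (f : Fin (m + 1) → AdequateSeq S) (hG : StrictMono G)
    (hf : ∀ i, f i ∈ (G i).1) :
    ∃ x ∈ (D (G (Fin.last m))).2.2.1, listProd (List.ofFn fun i =>
      omul (some (D (G i)).1) (seqProd (f i).1 (D (G i)).2.1)) = some x := by
  induction m with
  | zero =>
    obtain ⟨z, hz, hfz, -⟩ := (hD (G 0)).2 (f 0) (hf 0)
    exact ⟨z, hz, hfz⟩
  | succ m ih =>
    obtain ⟨x, hx, hprod⟩ := ih (fun i => G i.castSucc) (fun i => f i.castSucc)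
      (hG.comp Fin.strictMono_castSucc) fun i => hf _
    obtain ⟨z, -, hfz, hstep⟩ := (hD (G (Fin.last _))).2 (f (Fin.last _)) (hf _)
    obtain ⟨w, hw, hxw⟩ := hstep _ (hG (Fin.castSucc_lt_last (Fin.last m))) x hx
    refine ⟨w, hw, ?_⟩
    rw [List.ofFn_succ', List.concat_eq_append, listProd_append ?_ (List.cons_ne_nil _ _), hprod]
    · exact (congrArg (omul (some x)) hfz).trans hxw
    · simp

end Construction

end PartialSemigroup

theorem corollary3p5 {S : Type*} [PartialSemigroup S]
    (hcomm : PartialSemigroup.IsCommutative S) (hadeq : PartialSemigroup.IsAdequate S)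
    (A : Set S) (hA : PartialSemigroup.IsCentral A) :
    PartialSemigroup.IsCSet A := by
  obtain ⟨p, hpp, hp, hA⟩ := hA
  have hwf : WellFounded fun F G : PartialSemigroup.Pf (PartialSemigroup.AdequateSeq S) =>
      F.1 ⊂ G.1 := InvImage.wf Subtype.val Finset.isWellFounded_ssubset.wf
  obtain ⟨D, hD⟩ := PartialSemigroup.exists_forall_of_wellFounded hwf
    PartialSemigroup.ChainData.Extends
    (PartialSemigroup.ChainData.exists_extends hcomm hadeq hpp hp hA)
  refine ⟨fun F => (D F).1, fun F => (D F).2.1, fun F G hFG => (hD G).1 F hFG, ?_⟩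
  intro m G f hm hG hf
  obtain ⟨m, rfl⟩ := Nat.exists_eq_add_one_of_ne_zero hm.ne'
  obtain ⟨x, hx, hprod⟩ := PartialSemigroup.ChainData.listProd_mem hD m G f hG hf
  exact ⟨x, ((D _).2.2.2 x hx).1, hprod⟩
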